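/- There are $n$ cars $1,\dots,n$, entering in this order, and a one-way street with $n$ spots labeled $1,\dots,n$. Each car has a preferred spot and parks in the first spot on or after its preference that is not taken by an earlier car. A choice of preferences is a parking function of $1,\dots,n$ if every car is able to park. For a given parking function, a car is lucky if it parks in its preferred spot, and a spot is lucky if the car that parks in it prefers it. Let $q_n(i,j)$ be the number of parking functions of $1,\dots,n$ for which the $i$-th car prefers spot $j$ and is lucky. Then $\sum_{i=1}^n q_n(i,j)$ is the number of parking functions of $1,\dots,n$ for which spot $j$ is lucky, and \begin{align*} \sum_{i=1}^n q_n(i,3)&=\tfrac23(n+1)^{n-1}-\tfrac13(2n-1)(n-2)^{n-2} && (n\ge 3),\\ \sum_{i=1}^n q_n(i,4)&=\tfrac58(n+1)^{n-1}-\tfrac18(13n^2-26n+9)(n-3)^{n-3} && (n\ge 4),\\ \sum_{i=1}^n q_n(i,5)&=\tfrac35(n+1)^{n-1}-\tfrac1{30}(118n^3-531n^2+659n-192)(n-4)^{n-4} && (n\ge 5). \end{align*} Moreover, for $1\le j\le 5$ the limit $$\rho_j=\lim_{n\to\infty}\frac{1}{(n+1)^{n-1}}\sum_{i=1}^n q_n(i,j)$$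 exists and equals the limit as $n\to\infty$ of the probability that spot $j$ is lucky for a uniformly random parking function of $1,\dots,n$, and its values are $$\rho_1=1,\quad \rho_2=\tfrac34-\tfrac14e^{-2}=0.716166\ldots,\quad \rho_3=\tfrac23-\tfrac23e^{-3}=0.633475\ldots,$$ $$\rho_4=\tfrac58-\tfrac{13}8e^{-4}=0.595237\ldots,\quad \rho_5=\tfrac35-\tfrac{59}{15}e^{-5}=0.573497\ldots$$ -/

import Mathlib

open Filter Topology

namespace Parking

/-- There are `n` cars (entering in the order of `Fin n`) and `n` spots. The car `i` prefers
the spot `p i`. The map `s` is the outcome of parking when every car gets a spot: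
each car `i` parks in the first spot that is on or after its preference and
that is not taken by an earlier car. -/
def IsOutcome {n : ℕ} (p s : Fin n → Fin n) : Prop :=
  ∀ i, IsLeast {t : Fin n | p i ≤ t ∧ ∀ k, k < i → s k ≠ t} (s i)

/-- The outcome is determined by the preferences. -/
theorem IsOutcome.unique {n : ℕ} {p s s' : Fin n → Fin n}
    (h : IsOutcome p s) (h' : IsOutcome p s') : s = s' := by
  funext i
  induction i using WellFoundedLT.induction with
  | ind i ih =>
    have hset : {t : Fin n | p i ≤ t ∧ ∀ k, k < i → s k ≠ t} =
        {t : Fin n | p i ≤ t ∧ ∀ k, k < i → s' k ≠ t} := by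
      ext t
      constructor
      · rintro ⟨h1, h2⟩
        exact ⟨h1, fun k hk => by rw [← ih k hk]; exact h2 k hk⟩
      · rintro ⟨h1, h2⟩
        exact ⟨h1, fun k hk => by rw [ih k hk]; exact h2 k hk⟩
    have hi := h i
    rw [hset] at hi
    exact hi.unique (h' i)

/-- A parking function: preferences with which every car is able to park. -/
def IsParkingFunction {n : ℕ} (p : Fin n → Fin n) : Prop :=
  ∃ s, IsOutcome p s

/-- `p` is a parking function for which the car `i` is lucky: it parks in its preferred spot. -/
def IsLuckyCar {n : ℕ} (p : Fin n → Fin n) (i : Fin n) : Prop :=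
  ∃ s, IsOutcome p s ∧ s i = p i

/-- `p` is a parking function for which the spot `t` is lucky: a car that prefers `t` parks
in it. -/
def IsLuckySpot {n : ℕ} (p : Fin n → Fin n) (t : Fin n) : Prop :=
  ∃ s, IsOutcome p s ∧ ∃ i, s i = t ∧ p i = t

/-- The number of parking functions of `1, …, n`. -/
noncomputable def parkingCount (n : ℕ) : ℕ :=
  Set.ncard {p : Fin n → Fin n | IsParkingFunction p}

/-- The number of parking functions of `1, …, n` for which the spot with label `j` is lucky.
The spots carry the labels `1, …, n`, so `t : Fin n` is the spot with label `t + 1`. -/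
noncomputable def luckySpotCount (n j : ℕ) : ℕ :=
  Set.ncard {p : Fin n → Fin n | ∃ t : Fin n, (t : ℕ) + 1 = j ∧ IsLuckySpot p t}

/-- `q n i j` is the number of parking functions of `1, …, n` for which the car `i` prefers the
spot with label `j` and the car `i` is lucky. -/
noncomputable def q (n : ℕ) (i : Fin n) (j : ℕ) : ℕ :=
  Set.ncard {p : Fin n → Fin n | (p i : ℕ) + 1 = j ∧ IsLuckyCar p i}

/-- The `j`-th column sum: the sum of `q n i j` over all cars `i`. -/
noncomputable def columnSum (n j : ℕ) : ℕ :=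
  ∑ i : Fin n, q n i j

/-- The number `ρ` is the limit, as `n → ∞`, of the `j`-th column sum divided by
`(n + 1) ^ (n - 1)`, and of the probability that the spot with label `j` is lucky for a uniformly
random parking function of `1, …, n`. -/
def IsAsymptoticProbability (j : ℕ) (ρ : ℝ) : Prop :=
  Tendsto (fun n : ℕ => (columnSum n j : ℝ) / ((n : ℝ) + 1) ^ (n - 1)) atTop (𝓝 ρ) ∧
  Tendsto (fun n : ℕ => (luckySpotCount n j : ℝ) / (parkingCount n : ℝ)) atTop (𝓝 ρ)

end Parking

/-!
Whether a spot is taken can be read off the numbers of cars that prefer each interval of spots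
ending there: the spot `x` is taken as soon as, for some `s ≤ x`, at least `x + 1 - s` cars prefer
one of `s, …, x`. Preferences are a parking function iff no car is pushed out at the right end.

Conditioning on the last car gives the number of words over `t + 1` spots after which the last spot
is taken unluckily: `t / 2 * (t + 1) ^ (m - 1)` for `m > t` cars. Splitting such a word at its
leftmost free spot yields the number of those that leave no spot free, a combination of the
exponentials `(t - k) ^ (m - k)` and `(t + 1) ^ m`. A parking function for which the spot `t` is
unlucky is a shuffle of such a filling of `0, …, t` and of the cars that prefer a later spot. In the
resulting binomial convolution every exponential `(t - k) ^ (m - k)` cancels, so only `(t + 1) ^ m`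
and the finitely many `m < t`, for which the exponential formula fails, contribute. After division
by `(n + 1) ^ (n - 1)` the correction terms are Poisson probabilities in the limit.
-/

namespace Parking

open Finset

section Words

variable {α : Type*}

/-- The set of words of length `n` over the alphabet `A`. A word lists the preferences of the
cars of a street, the most recent car first. -/
def words (A : Finset α) : ℕ → Finset (List α)
  | 0 => {[]}
  | n + 1 => (A ×ˢ words A n).map ⟨fun x => x.1 :: x.2, by rintro ⟨⟩ ⟨⟩; simp⟩

theorem mem_words {A : Finset α} {n : ℕ} {w : List α} :
    w ∈ words A n ↔ w.length = n ∧ ∀ a ∈ w, a ∈ A := by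
  induction n generalizing w with
  | zero => cases w <;> simp [words]
  | succ n ih =>
    simp only [words, Finset.mem_map, mem_product, ih]
    change (∃ x : α × List α, _ ∧ x.1 :: x.2 = w) ↔ _
    cases w <;> simp [and_left_comm]

open Classical in
/-- The number of words of length `n` over the alphabet `A` with the property `P`. -/
noncomputable def wordCount (A : Finset α) (P : List α → Prop) (n : ℕ) : ℕ :=
  #{w ∈ words A n | P w}

theorem wordCount_congr {A B : Finset α} {P Q : List α → Prop} {n : ℕ}
    (h : ∀ w : List α, w.length = n →
      ((∀ a ∈ w, a ∈ A) ∧ P w ↔ (∀ a ∈ w, a ∈ B) ∧ Q w)) :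
    wordCount A P n = wordCount B Q n := by
  unfold wordCount
  congr 1
  ext w
  simp only [mem_filter, mem_words, and_assoc]
  exact and_congr_right (h w)

theorem wordCount_eq_zero {A : Finset α} {P : List α → Prop} {n : ℕ}
    (h : ∀ w ∈ words A n, ¬ P w) : wordCount A P n = 0 := by
  simpa [wordCount, filter_eq_empty_iff] using h

open Classical in
theorem wordCount_zero (A : Finset α) (P : List α → Prop) :
    wordCount A P 0 = if P [] then 1 else 0 := by
  split_ifs with h <;> simp [wordCount, words, filter_singleton, h]

theorem wordCount_succ (A : Finset α) (P : List α → Prop) (n : ℕ) :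
    wordCount A P (n + 1) = ∑ a ∈ A, wordCount A (fun w => P (a :: w)) n := by
  simp only [wordCount, words, card_filter, sum_map, sum_product]
  rfl

theorem wordCount_singleton_true (a : α) (n : ℕ) : wordCount {a} (fun _ => True) n = 1 := by
  induction n with
  | zero => simp [wordCount_zero]
  | succ n ih => simpa [wordCount_succ] using ih

theorem wordCount_and_add_and_not (A : Finset α) (P Q : List α → Prop) (n : ℕ) :
    wordCount A (fun w => P w ∧ Q w) n + wordCount A (fun w => P w ∧ ¬ Q w) n =
      wordCount A P n := by
  classical
  simp only [wordCount, ← filter_filter]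
  convert card_filter_add_card_filter_not (s := {w ∈ words A n | P w}) Q

theorem wordCount_or {P Q : List α → Prop} (h : ∀ w, P w → ¬ Q w) (A : Finset α) (n : ℕ) :
    wordCount A (fun w => P w ∨ Q w) n = wordCount A P n + wordCount A Q n := by
  rw [← wordCount_and_add_and_not A (fun w => P w ∨ Q w) P]
  congr 2 <;> ext w <;> grind

theorem wordCount_eq_sum_first_failure (A : Finset α) (P : List α → Prop)
    (Q : ℕ → List α → Prop) (j n : ℕ) :
    wordCount A P n = wordCount A (fun w => P w ∧ ∀ x < j, Q x w) n +
      ∑ k ∈ range j, wordCount A (fun w => P w ∧ (∀ x < k, Q x w) ∧ ¬ Q k w) n := by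
  induction j with
  | zero => simp
  | succ j ih =>
    have hsplit := wordCount_and_add_and_not A (fun w => P w ∧ ∀ x < j, Q x w) (Q j) n
    simp only [and_assoc, ← Nat.forall_lt_succ_right] at hsplit
    rw [ih, sum_range_succ, ← hsplit]
    ring

theorem wordCount_filter_and_filter_not (A : Finset α) (c : α → Prop) [DecidablePred c]
    (P Q : List α → Prop) (n : ℕ) :
    wordCount A (fun w => P (w.filter c) ∧ Q (w.filter (¬ c ·))) n =
      ∑ z ∈ antidiagonal n, n.choose z.1 *
        (wordCount {a ∈ A | c a} P z.1 * wordCount {a ∈ A | ¬ c a} Q z.2) := by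
  classical
  induction n generalizing P Q with
  | zero => by_cases hP : P [] <;> by_cases hQ : Q [] <;> simp [wordCount_zero, hP, hQ]
  | succ n ih =>
    have hpascal := sum_antidiagonal_choose_succ_mul (R := ℕ)
      (fun i j => wordCount {a ∈ A | c a} P i * wordCount {a ∈ A | ¬ c a} Q j) n
    have hchoose : ∀ z ∈ antidiagonal n, n.choose z.2 = n.choose z.1 := fun z hz => by
      rw [← mem_antidiagonal.1 hz, Nat.choose_symm_add]
    have hc : ∀ a ∈ A.filter c,
        wordCount A (fun w => P ((a :: w).filter c) ∧ Q ((a :: w).filter (¬ c ·))) n =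
          ∑ z ∈ antidiagonal n, n.choose z.2 * (wordCount {a ∈ A | c a} (fun w => P (a :: w)) z.1 *
            wordCount {a ∈ A | ¬ c a} Q z.2) := fun a ha => by
      rw [sum_congr rfl fun z hz => by rw [hchoose z hz], ← ih]
      simp [(mem_filter.1 ha).2]
    have hnc : ∀ a ∈ A.filter (¬ c ·),
        wordCount A (fun w => P ((a :: w).filter c) ∧ Q ((a :: w).filter (¬ c ·))) n =
          ∑ z ∈ antidiagonal n, n.choose z.1 * (wordCount {a ∈ A | c a} P z.1 *
            wordCount {a ∈ A | ¬ c a} (fun w => Q (a :: w)) z.2) := fun a ha => by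
      rw [← ih]
      simp [(mem_filter.1 ha).2]
    rw [wordCount_succ, ← sum_filter_add_sum_filter_not A c, sum_congr rfl hc,
      sum_congr rfl hnc, sum_comm, sum_comm (s := A.filter (¬ c ·))]
    simp only [Nat.cast_id] at hpascal
    simp only [hpascal, wordCount_succ, sum_mul, mul_sum]
    exact add_comm _ _

theorem wordCount_Ico_filter_le_and_filter_lt {lo k hi : ℕ} (hlo : lo ≤ k + 1) (hhi : k + 1 ≤ hi)
    (P Q : List ℕ → Prop) (n : ℕ) :
    wordCount (Ico lo hi) (fun w => P (w.filter (· ≤ k)) ∧ Q (w.filter (k < ·))) n =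
      ∑ z ∈ antidiagonal n, n.choose z.1 *
        (wordCount (Ico lo (k + 1)) P z.1 * wordCount (Ico (k + 1) hi) Q z.2) := by
  have hsplit := wordCount_filter_and_filter_not (Ico lo hi) (· ≤ k) P Q n
  simp only [not_le] at hsplit
  convert hsplit using 6 <;> grind

end Words

section Occupancy

variable {w : List ℕ} {a k s t x : ℕ}

/-- The number of cars that prefer one of the spots `s, …, t - 1`. -/
def demand (w : List ℕ) (s t : ℕ) : ℕ :=
  w.countP (· ∈ Ico s t)

/-- The spot `x` is taken on a street that never ends on the right, after the cars with the
preferences `w` have parked. The criterion in terms of demand does not mention the parking process;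
`occupied_cons` shows that the two agree. -/
def Occupied (w : List ℕ) (x : ℕ) : Prop :=
  ∃ s ≤ x, x + 1 ≤ s + demand w s (x + 1)

/-- Some car of `w` that prefers another spot parks in the spot `t`. -/
def Unlucky (t : ℕ) : List ℕ → Prop
  | [] => False
  | a :: w => Unlucky t w ∨ (a ≠ t ∧ ¬ Occupied w t ∧ Occupied (a :: w) t)

theorem demand_cons (a : ℕ) (w : List ℕ) (s t : ℕ) :
    demand (a :: w) s t = demand w s t + if a ∈ Ico s t then 1 else 0 := by
  simp [demand, List.countP_cons]

theorem demand_add_demand (w : List ℕ) (hsk : s ≤ k) (hkt : k ≤ t) :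
    demand w s k + demand w k t = demand w s t := by
  induction w with
  | nil => simp [demand]
  | cons a w ih =>
    simp only [demand_cons, ← ih, mem_Ico]
    grind

theorem demand_le_length (w : List ℕ) (s t : ℕ) : demand w s t ≤ w.length :=
  List.countP_le_length

theorem demand_eq_length (h : ∀ a ∈ w, a ∈ Ico s t) : demand w s t = w.length :=
  List.countP_eq_length.2 (by simpa using h)

theorem demand_filter_le (w : List ℕ) (c : ℕ → Bool) (s t : ℕ) :
    demand (w.filter c) s t ≤ demand w s t :=
  List.filter_sublist.countP_le

theorem demand_filter {c : ℕ → Bool} (h : ∀ a ∈ Ico s t, c a) (w : List ℕ) :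
    demand (w.filter c) s t = demand w s t := by
  rw [demand, List.countP_filter, demand]
  exact List.countP_congr fun a _ => by simpa using fun h₁ h₂ => h a (mem_Ico.2 ⟨h₁, h₂⟩)

theorem exists_le_add_demand_of_forall_occupied (hax : a ≤ x)
    (h : ∀ y, a ≤ y → y < x → Occupied w y) : ∃ s ≤ a, x ≤ s + demand w s x := by
  induction x using Nat.strong_induction_on with
  | _ x ih =>
    obtain rfl | hlt := hax.eq_or_lt
    · exact ⟨a, le_rfl, Nat.le_add_right _ _⟩
    obtain ⟨y, rfl⟩ := Nat.exists_eq_add_one_of_ne_zero (by lia : x ≠ 0)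
    obtain ⟨s, hsy, hs⟩ := h y (by lia) (by lia)
    obtain hsa | has := le_or_gt s a
    · exact ⟨s, hsa, hs⟩
    obtain ⟨s', hs'a, hs'⟩ := ih s (by lia) has.le fun z haz hzs => h z haz (by lia)
    have := demand_add_demand w (by lia : s' ≤ s) (by lia : s ≤ y + 1)
    exact ⟨s', hs'a, by lia⟩

theorem le_length_of_forall_occupied (h : ∀ y < x, Occupied w y) : x ≤ w.length := by
  obtain ⟨s, hs, hx⟩ := exists_le_add_demand_of_forall_occupied x.zero_le fun y _ => h y
  have := demand_le_length w s x
  lia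

theorem occupied_cons :
    Occupied (a :: w) x ↔ Occupied w x ∨ (a ≤ x ∧ ∀ y, a ≤ y → y < x → Occupied w y) := by
  constructor
  · rintro ⟨s, hsx, hs⟩
    by_cases hx : Occupied w x
    · exact .inl hx
    simp only [Occupied, not_exists, not_and, not_le] at hx
    have hmem : a ∈ Ico s (x + 1) := by
      by_contra ha
      rw [demand_cons, if_neg ha] at hs
      exact (hx s hsx).not_ge hs
    rw [demand_cons, if_pos hmem] at hs
    rw [mem_Ico] at hmem
    refine .inr ⟨by lia, fun y hay hyx => ⟨s, by lia, ?_⟩⟩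
    have hsum := demand_add_demand w (by lia : s ≤ y + 1) (by lia : y + 1 ≤ x + 1)
    have hright := hx (y + 1) hyx
    lia
  · rintro (⟨s, hsx, hs⟩ | ⟨hax, h⟩)
    · exact ⟨s, hsx, by rw [demand_cons]; lia⟩
    · obtain ⟨s, hsa, hs⟩ := exists_le_add_demand_of_forall_occupied hax h
      have := demand_add_demand w (by lia : s ≤ x) (by lia : x ≤ x + 1)
      refine ⟨s, by lia, ?_⟩
      rw [demand_cons, if_pos (mem_Ico.2 ⟨hsa, by lia⟩)]
      lia

theorem not_occupied_nil : ¬ Occupied [] x := by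
  rintro ⟨s, hsx, hs⟩
  simp only [demand, List.countP_nil] at hs
  lia

theorem Occupied.cons (h : Occupied w x) : Occupied (a :: w) x :=
  occupied_cons.2 (.inl h)

theorem occupied_cons_self : Occupied (x :: w) x :=
  occupied_cons.2 (.inr ⟨le_rfl, fun _ hy hyx => absurd hy hyx.not_ge⟩)

theorem occupied_of_mem (h : x ∈ w) : Occupied w x :=
  ⟨x, le_rfl, by
    have : 0 < demand w x (x + 1) := List.countP_pos_iff.2 ⟨x, h, by simp⟩
    lia⟩

theorem occupied_cons_of_lt (h : x < a) : Occupied (a :: w) x ↔ Occupied w x := by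
  simp [occupied_cons, h.not_ge]

theorem Occupied.of_filter {c : ℕ → Bool} : Occupied (w.filter c) x → Occupied w x := by
  rintro ⟨s, hsx, hs⟩
  exact ⟨s, hsx, hs.trans (Nat.add_le_add_left (demand_filter_le w c s _) s)⟩

theorem occupied_filter_le (h : x ≤ k) : Occupied (w.filter (· ≤ k)) x ↔ Occupied w x := by
  refine exists_congr fun s => and_congr_right fun _ => ?_
  rw [demand_filter fun a ha => by simp only [mem_Ico] at ha; simpa using by lia]

theorem occupied_filter_lt (hk : ¬ Occupied w k) (h : k < x) :
    Occupied (w.filter (k < ·)) x ↔ Occupied w x := by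
  refine ⟨.of_filter, fun ⟨s, hsx, hs⟩ => ?_⟩
  have hdemand : ∀ r, k < r →
      demand (w.filter (k < ·)) r (x + 1) = demand w r (x + 1) := fun r hr =>
    demand_filter (fun a ha => by simp only [mem_Ico] at ha; simpa using by lia) w
  obtain hks | hsk := lt_or_ge k s
  · exact ⟨s, hsx, by rwa [hdemand s hks]⟩
  · refine ⟨k + 1, h, ?_⟩
    have hleft : ¬ k + 1 ≤ s + demand w s (k + 1) := fun h => hk ⟨s, hsk, h⟩
    have hsum := demand_add_demand w (by lia : s ≤ k + 1) (by lia : k + 1 ≤ x + 1)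
    rw [hdemand _ (Nat.lt_succ_self k)]
    lia

theorem occupied_filter_lt_of_add_length_le (h : k + w.length ≤ x) :
    Occupied (w.filter (k < ·)) x ↔ Occupied w x := by
  refine ⟨.of_filter, fun ⟨s, hsx, hs⟩ => ⟨s, hsx, ?_⟩⟩
  have := demand_le_length w s (x + 1)
  rwa [demand_filter fun a ha => by simp only [mem_Ico] at ha; simpa using by lia]

theorem forall_occupied_and_not_occupied_iff (hw : ∀ a ∈ w, a ≤ k) :
    (∀ x < k, Occupied w x) ∧ ¬ Occupied w k ↔ w.length = k ∧ ¬ Occupied w k := by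
  refine and_congr_left fun hk => ?_
  simp only [Occupied, not_exists, not_and, not_le] at hk
  have hlength : demand w 0 (k + 1) = w.length :=
    demand_eq_length fun a ha => by simpa using Nat.lt_succ_of_le (hw a ha)
  have hle := hk 0 k.zero_le
  constructor
  · intro h
    have := le_length_of_forall_occupied h
    lia
  · rintro hwk x hx
    by_contra hfree
    simp only [Occupied, not_exists, not_and, not_le] at hfree
    have hleft := hfree 0 x.zero_le
    have hright := hk (x + 1) hx
    have hsum := demand_add_demand w (x + 1).zero_le (by lia : x + 1 ≤ k + 1)
    lia

theorem not_occupied_length_iff (hw : ∀ a ∈ w, a ≤ w.length) (ht : t < w.length) :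
    ¬ Occupied w w.length ↔ (∀ x < t + 1, Occupied (w.filter (· ≤ t)) x) ∧
      ¬ Occupied (w.filter (t < ·)) w.length := by
  constructor
  · intro h
    have hall := ((forall_occupied_and_not_occupied_iff hw).2 ⟨rfl, h⟩).1
    exact ⟨fun x hx => (occupied_filter_le (by lia)).2 (hall x (by lia)), mt .of_filter h⟩
  · rintro ⟨hleft, hright⟩ ⟨s, hs, hdemand⟩
    obtain hst | hts := le_or_gt s t
    · obtain ⟨r, hr, hdr⟩ := exists_le_add_demand_of_forall_occupied (w := w) s.zero_le
        fun y _ hy => (occupied_filter_le (by lia)).1 (hleft y (by lia))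
      have hsum := demand_add_demand w (by lia : r ≤ s) (by lia : s ≤ w.length + 1)
      have := demand_le_length w r (w.length + 1)
      lia
    · refine hright ⟨s, hs, ?_⟩
      rwa [demand_filter fun a ha => by simp only [mem_Ico] at ha; simpa using by lia]

theorem unlucky_cons :
    Unlucky t (a :: w) ↔ Unlucky t w ∨ (a ≠ t ∧ ¬ Occupied w t ∧ Occupied (a :: w) t) :=
  Iff.rfl

theorem Unlucky.occupied (h : Unlucky t w) : Occupied w t := by
  induction w with
  | nil => exact h.elim
  | cons a w ih => exact h.elim (fun h => (ih h).cons) fun h => h.2.2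

theorem unlucky_or_not_occupied_cons :
    Unlucky t (a :: w) ∨ ¬ Occupied (a :: w) t ↔
      Unlucky t w ∨ (¬ Occupied w t ∧ a ≠ t) := by
  have hcons : Occupied w t → Occupied (a :: w) t := Occupied.cons
  have hself : a = t → Occupied (a :: w) t := by rintro rfl; exact occupied_cons_self
  rw [unlucky_cons]
  tauto

theorem unlucky_filter_le (h : t ≤ k) : Unlucky t (w.filter (· ≤ k)) ↔ Unlucky t w := by
  induction w with
  | nil => rfl
  | cons a w ih =>
    by_cases ha : a ≤ k
    · have hcons := occupied_filter_le (w := a :: w) h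
      rw [List.filter_cons_of_pos (by simpa using ha)] at hcons ⊢
      rw [unlucky_cons, unlucky_cons, ih, occupied_filter_le h, hcons]
    · rw [List.filter_cons_of_neg (by simpa using ha), ih, unlucky_cons,
        occupied_cons_of_lt (by lia)]
      tauto

theorem unlucky_filter_lt (hk : ¬ Occupied w k) (h : k < t) :
    Unlucky t (w.filter (k < ·)) ↔ Unlucky t w := by
  induction w with
  | nil => rfl
  | cons a w ih =>
    have hk' : ¬ Occupied w k := mt Occupied.cons hk
    have hcons := occupied_filter_lt hk h
    by_cases ha : k < a
    · rw [List.filter_cons_of_pos (by simpa using ha)] at hcons ⊢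
      rw [unlucky_cons, unlucky_cons, ih hk', occupied_filter_lt hk' h, hcons]
    · rw [List.filter_cons_of_neg (by simpa using ha)] at hcons ⊢
      rw [ih hk', unlucky_cons, ← hcons, occupied_filter_lt hk' h]
      tauto

end Occupancy

section BinomialSums

variable {R : Type*} [CommRing R]

theorem sum_antidiagonal_choose_mul_pow_mul_pow (n : ℕ) (x y : R) :
    ∑ z ∈ antidiagonal n, n.choose z.1 * (x ^ z.1 * y ^ z.2) = (x + y) ^ n := by
  simp only [(Commute.all x y).add_pow', nsmul_eq_mul]

theorem add_mul_sum_choose_mul_mul_pow (n : ℕ) (x y : R) :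
    (x + y) * ∑ z ∈ antidiagonal n, n.choose z.1 * (z.1 * (x ^ z.1 * y ^ z.2)) =
      n * x * (x + y) ^ n := by
  cases n with
  | zero => simp
  | succ n =>
    have habsorb (i : ℕ) : ((n + 1).choose (i + 1) : R) * (i + 1) = (n + 1) * n.choose i :=
      mod_cast congrArg (Nat.cast (R := R)) (Nat.add_one_mul_choose_eq n i).symm
    rw [Nat.sum_antidiagonal_succ, pow_succ' (x + y),
      ← sum_antidiagonal_choose_mul_pow_mul_pow n, mul_left_comm _ (x + y), mul_sum (a := _ * x)]
    simp only [Nat.cast_zero, zero_mul, mul_zero, zero_add, Nat.cast_add, Nat.cast_one]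
    refine congrArg _ (sum_congr rfl fun z _ => ?_)
    linear_combination x ^ (z.1 + 1) * y ^ z.2 * habsorb z.1

theorem add_mul_sum_choose_mul_add_mul_pow (n : ℕ) (c x y : R) :
    (x + y) * ∑ z ∈ antidiagonal n, n.choose z.1 * ((z.1 + c) * x ^ z.1 * y ^ z.2) =
      (n * x + c * (x + y)) * (x + y) ^ n := by
  rw [add_mul (n * x), mul_assoc c, mul_left_comm c, ← add_mul_sum_choose_mul_mul_pow,
    ← sum_antidiagonal_choose_mul_pow_mul_pow, mul_sum (a := c), ← mul_add, ← sum_add_distrib]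
  exact congrArg _ (sum_congr rfl fun z _ => by ring)

theorem add_mul_sum_choose_mul_choose_mul_add_mul_pow {k n : ℕ} (h : k ≤ n) (c x y : R) :
    (x + y) * ∑ z ∈ antidiagonal n,
        n.choose z.1 * (z.1.choose k * ((z.1 + c) * x ^ (z.1 - k) * y ^ z.2)) =
      n.choose k * (((n - k) * x + (k + c) * (x + y)) * (x + y) ^ (n - k)) := by
  obtain ⟨l, rfl⟩ := Nat.exists_eq_add_of_le h
  have hzero : ∀ i ∈ range k, ((k + l).choose i : R) *
      (i.choose k * ((i + c) * x ^ (i - k) * y ^ (k + l - i))) = 0 := fun i hi => by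
    simp [Nat.choose_eq_zero_of_lt (mem_range.1 hi)]
  have hshift (i : ℕ) : ((k + l).choose (k + i) : R) * ((k + i).choose k *
      (((k + i : ℕ) + c) * x ^ (k + i - k) * y ^ (k + l - (k + i)))) =
      (k + l).choose k * (l.choose i * ((i + (k + c)) * x ^ i * y ^ (l - i))) := by
    have hmul : ((k + l).choose (k + i) * (k + i).choose k : R) =
        (k + l).choose k * l.choose i := by
      have := Nat.choose_mul (n := k + l) (k := k + i) (s := k) (Nat.le_add_right k i)
      simp only [Nat.add_sub_cancel_left] at this
      exact mod_cast congrArg (Nat.cast (R := R)) this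
    rw [Nat.add_sub_cancel_left, Nat.add_sub_add_left, ← mul_assoc, hmul]
    push_cast
    ring
  have hmain := add_mul_sum_choose_mul_add_mul_pow l (k + c) x y
  simp only [Nat.sum_antidiagonal_eq_sum_range_succ_mk, Nat.succ_eq_add_one] at hmain ⊢
  rw [add_assoc k l 1, sum_range_add, sum_eq_zero hzero, zero_add,
    sum_congr rfl fun i _ => hshift i, ← mul_sum, mul_left_comm, hmain]
  simp

end BinomialSums

section FreeSpots

theorem wordCount_not_occupied_eq_zero (lo : ℕ) {s r : ℕ} (h : s < r) :
    wordCount (Ico lo (lo + s + 1)) (¬ Occupied · (lo + s)) r = 0 := by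
  refine wordCount_eq_zero fun w hw hfree => hfree ⟨lo, Nat.le_add_right _ _, ?_⟩
  rw [mem_words] at hw
  rw [demand_eq_length hw.2]
  lia

theorem wordCount_not_occupied_succ (lo : ℕ) {s r : ℕ} (h : r ≤ s + 1) :
    wordCount (Ico lo (lo + (s + 1) + 1)) (¬ Occupied · (lo + (s + 1))) r =
      ∑ z ∈ antidiagonal r, r.choose z.1 *
        wordCount (Ico (lo + 1) (lo + 1 + s + 1)) (¬ Occupied · (lo + 1 + s)) z.2 := by
  have hsplit := wordCount_Ico_filter_le_and_filter_lt (lo := lo) (k := lo)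
    (hi := lo + (s + 1) + 1) (by lia) (by lia) (fun _ => True) (¬ Occupied · (lo + (s + 1))) r
  simp only [Nat.Ico_succ_singleton, wordCount_singleton_true, one_mul, true_and] at hsplit
  rw [add_assoc lo 1 s, add_comm 1 s, ← hsplit]
  refine wordCount_congr fun w hw => and_congr_right fun _ => ?_
  rw [occupied_filter_lt_of_add_length_le (by lia)]

theorem add_one_mul_wordCount_not_occupied (lo : ℕ) {s r : ℕ} (h : r ≤ s + 1) :
    ((s : ℝ) + 1) * wordCount (Ico lo (lo + s + 1)) (¬ Occupied · (lo + s)) r =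
      (s + 1 - r) * (s + 1) ^ r := by
  induction s generalizing lo r with
  | zero =>
    obtain rfl | rfl : r = 0 ∨ r = 1 := by lia
    · simp [wordCount_zero, not_occupied_nil]
    · rw [wordCount_not_occupied_eq_zero lo Nat.zero_lt_one]
      simp
  | succ s ih =>
    obtain rfl | hr : r = s + 2 ∨ r ≤ s + 1 := by lia
    · rw [wordCount_not_occupied_eq_zero lo (Nat.lt_succ_self (s + 1))]
      push_cast
      ring
    · have hs : (s : ℝ) + 1 ≠ 0 := by positivity
      have hterm : ∀ z ∈ antidiagonal r, ((s : ℝ) + 1) * (r.choose z.1 *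
          wordCount (Ico (lo + 1) (lo + 1 + s + 1)) (¬ Occupied · (lo + 1 + s)) z.2) =
          r.choose z.1 * ((z.1 + (s + 1 - r)) * 1 ^ z.1 * ((s : ℝ) + 1) ^ z.2) := fun z hz => by
        have hsum := mem_antidiagonal.1 hz
        rw [mul_left_comm, ih (lo + 1) (by lia), ← hsum]
        push_cast
        ring
      have hbinom := add_mul_sum_choose_mul_add_mul_pow r ((s : ℝ) + 1 - r) 1 (s + 1)
      rw [← sum_congr rfl hterm, ← mul_sum] at hbinom
      rw [wordCount_not_occupied_succ lo hr]
      push_cast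
      refine mul_left_cancel₀ hs ?_
      linear_combination hbinom

theorem wordCount_not_occupied_self (n : ℕ) :
    (wordCount (Ico 0 (n + 1)) (¬ Occupied · n) n : ℝ) = (n + 1) ^ n / (n + 1) := by
  have h := add_one_mul_wordCount_not_occupied 0 (Nat.le_succ n)
  simp only [zero_add] at h
  rw [eq_div_iff (by positivity)]
  linear_combination h

end FreeSpots

section UnluckySpots

theorem wordCount_unlucky_succ (lo s m : ℕ) :
    wordCount (Ico lo (lo + s + 1)) (Unlucky (lo + s)) (m + 1) +
        wordCount (Ico lo (lo + s + 1)) (¬ Occupied · (lo + s)) (m + 1) =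
      (s + 1) * wordCount (Ico lo (lo + s + 1)) (Unlucky (lo + s)) m +
        s * wordCount (Ico lo (lo + s + 1)) (¬ Occupied · (lo + s)) m := by
  have hdisj : ∀ w, Unlucky (lo + s) w → ¬ ¬ Occupied w (lo + s) := fun w h => not_not.2 h.occupied
  have hbelow : ∀ a ∈ Ico lo (lo + s),
      wordCount (Ico lo (lo + s + 1))
          (fun w => Unlucky (lo + s) (a :: w) ∨ ¬ Occupied (a :: w) (lo + s)) m =
        wordCount (Ico lo (lo + s + 1)) (Unlucky (lo + s)) m +
          wordCount (Ico lo (lo + s + 1)) (¬ Occupied · (lo + s)) m := fun a ha => by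
    simp only [unlucky_or_not_occupied_cons, (mem_Ico.1 ha).2.ne, ne_eq, not_false_eq_true,
      and_true, wordCount_or hdisj]
  rw [← wordCount_or hdisj, wordCount_succ, sum_Ico_succ_top (Nat.le_add_right _ _),
    sum_congr rfl hbelow]
  simp only [unlucky_or_not_occupied_cons, ne_eq, not_true, and_false, or_false, sum_const,
    Nat.card_Ico, Nat.add_sub_cancel_left, smul_eq_mul]
  ring

theorem two_mul_add_one_sq_mul_wordCount_unlucky (lo : ℕ) {s m : ℕ} (h : m ≤ s + 1) :
    2 * ((s : ℝ) + 1) ^ 2 * wordCount (Ico lo (lo + s + 1)) (Unlucky (lo + s)) m =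
      m * (m - 1) * (s + 1) ^ m := by
  induction m with
  | zero => simp [wordCount_zero, Unlucky]
  | succ m ih =>
    have hrec := congrArg (Nat.cast (R := ℝ)) (wordCount_unlucky_succ lo s m)
    have hfree := add_one_mul_wordCount_not_occupied lo (by lia : m ≤ s + 1)
    have hfree' := add_one_mul_wordCount_not_occupied lo h
    push_cast at hrec hfree' ⊢
    linear_combination 2 * ((s : ℝ) + 1) ^ 2 * hrec + (s + 1) * ih (by lia) +
      2 * (s + 1) * s * hfree - 2 * (s + 1) * hfree'

theorem two_mul_add_one_mul_wordCount_unlucky (lo : ℕ) {s m : ℕ} (h : s < m) :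
    2 * ((s : ℝ) + 1) * wordCount (Ico lo (lo + s + 1)) (Unlucky (lo + s)) m =
      s * (s + 1) ^ m := by
  induction m, h using Nat.le_induction with
  | base =>
    have hs : (s : ℝ) + 1 ≠ 0 := by positivity
    have h := two_mul_add_one_sq_mul_wordCount_unlucky lo (le_refl (s + 1))
    push_cast at h
    refine mul_left_cancel₀ hs ?_
    simp only [Nat.succ_eq_add_one]
    linear_combination h
  | succ m hm ih =>
    have hrec := congrArg (Nat.cast (R := ℝ)) (wordCount_unlucky_succ lo s m)
    rw [wordCount_not_occupied_eq_zero lo (by lia), wordCount_not_occupied_eq_zero lo (by lia)]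
      at hrec
    push_cast at hrec
    linear_combination 2 * ((s : ℝ) + 1) * hrec + (s + 1) * ih

end UnluckySpots

section UnluckyFill

/-- The number of words over the spots `0, …, t` after which all these spots are taken, the spot `t`
by a car that prefers another one. (If the spot `t` is unlucky, then it is taken.) -/
noncomputable def unluckyFillCount (t m : ℕ) : ℕ :=
  wordCount (Ico 0 (t + 1)) (fun w => Unlucky t w ∧ ∀ x < t, Occupied w x) m

/-- The exponential expression in `m` that equals `unluckyFillCount t m` for `m > t`. Its values at
`m < t` are what distinguishes the lucky spot counts from a multiple of the number of parking
functions. -/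
noncomputable def unluckyFillExtension (t m : ℕ) : ℝ :=
  t / (2 * (t + 1)) * (t + 1) ^ m -
    ∑ k ∈ range t, (m.choose k : ℝ) * (((k : ℝ) + 1) ^ k / (k + 1) *
      (((t : ℝ) - k - 1) / (2 * (t - k)) * ((t : ℝ) - k) ^ (m - k)))

theorem unluckyFillCount_eq_zero {t m : ℕ} (h : m ≤ t) : unluckyFillCount t m = 0 := by
  refine wordCount_eq_zero fun w hw ⟨hunlucky, hocc⟩ => ?_
  have := le_length_of_forall_occupied (Nat.forall_lt_succ_right.2 ⟨hocc, hunlucky.occupied⟩)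
  rw [(mem_words.1 hw).1] at this
  lia

theorem wordCount_leftmost_free_spot {k t : ℕ} (h : k < t) (m : ℕ) :
    wordCount (Ico 0 (t + 1))
        (fun w => Unlucky t w ∧ (∀ x < k, Occupied w x) ∧ ¬ Occupied w k) m =
      m.choose k * (wordCount (Ico 0 (k + 1)) (¬ Occupied · k) k *
        wordCount (Ico (k + 1) (t + 1)) (Unlucky t) (m - k)) := by
  have hfilter (w : List ℕ) : Unlucky t w ∧ (∀ x < k, Occupied w x) ∧ ¬ Occupied w k ↔
      ((∀ x < k, Occupied (w.filter (· ≤ k)) x) ∧ ¬ Occupied (w.filter (· ≤ k)) k) ∧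
        Unlucky t (w.filter (k < ·)) := by
    by_cases hk : Occupied w k
    · simp [occupied_filter_le, hk]
    have hocc : (∀ x < k, Occupied (w.filter (· ≤ k)) x) ↔ ∀ x < k, Occupied w x :=
      forall₂_congr fun x hx => occupied_filter_le hx.le
    rw [occupied_filter_le le_rfl, hocc, unlucky_filter_lt hk h, and_comm]
  have hprefix (i : ℕ) : wordCount (Ico 0 (k + 1))
      (fun w => (∀ x < k, Occupied w x) ∧ ¬ Occupied w k) i =
        wordCount (Ico 0 (k + 1)) (fun w => i = k ∧ ¬ Occupied w k) i := by
    refine wordCount_congr fun w hw => and_congr_right fun hmem => ?_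
    rw [forall_occupied_and_not_occupied_iff fun a ha => by simpa using hmem a ha, hw]
  simp only [hfilter]
  rw [wordCount_Ico_filter_le_and_filter_lt (by lia) (by lia)
    (fun w => (∀ x < k, Occupied w x) ∧ ¬ Occupied w k), Nat.sum_antidiagonal_eq_sum_range_succ_mk,
    sum_eq_single k]
  · simp only [hprefix, true_and]
  · intro i _ hik
    rw [hprefix, wordCount_eq_zero fun w _ hw => hik hw.1, zero_mul, mul_zero]
  · intro hkm
    rw [Nat.choose_eq_zero_of_lt (by simpa using hkm), zero_mul]

theorem wordCount_unlucky_eq_unluckyFillCount_add (t m : ℕ) :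
    wordCount (Ico 0 (t + 1)) (Unlucky t) m = unluckyFillCount t m +
      ∑ k ∈ range t, m.choose k * (wordCount (Ico 0 (k + 1)) (¬ Occupied · k) k *
        wordCount (Ico (k + 1) (t + 1)) (Unlucky t) (m - k)) := by
  rw [wordCount_eq_sum_first_failure _ _ (fun x w => Occupied w x) t, unluckyFillCount]
  congr 1
  exact sum_congr rfl fun k hk => wordCount_leftmost_free_spot (mem_range.1 hk) m

theorem unluckyFillCount_eq_unluckyFillExtension {t m : ℕ} (h : t < m) :
    (unluckyFillCount t m : ℝ) = unluckyFillExtension t m := by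
  have hsum := congrArg (Nat.cast (R := ℝ)) (wordCount_unlucky_eq_unluckyFillCount_add t m)
  have htotal := two_mul_add_one_mul_wordCount_unlucky 0 h
  have hterm : ∀ k ∈ range t, (wordCount (Ico (k + 1) (t + 1)) (Unlucky t) (m - k) : ℝ) =
      (t - k - 1) / (2 * (t - k)) * (t - k) ^ (m - k) := fun k hk => by
    obtain ⟨s, rfl⟩ := Nat.exists_eq_add_of_lt (mem_range.1 hk)
    have := two_mul_add_one_mul_wordCount_unlucky (k + 1) (by lia : s < m - k)
    rw [add_right_comm k 1 s] at this
    push_cast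
    have hs : (s : ℝ) + 1 ≠ 0 := by positivity
    rw [show (k : ℝ) + s + 1 - k = s + 1 by ring]
    field_simp
    linear_combination this
  push_cast at hsum
  rw [zero_add] at htotal
  rw [unluckyFillExtension, eq_sub_iff_add_eq]
  rw [sum_congr rfl fun k hk => by rw [hterm k hk, wordCount_not_occupied_self]] at hsum
  rw [← hsum]
  field_simp
  linear_combination htotal

end UnluckyFill

section Outcomes

variable {m n t : ℕ}

theorem occupied_cons_of_first_free {w : List ℕ} {a b x : ℕ} (hab : a ≤ b) (hb : ¬ Occupied w b)
    (hfirst : ∀ y, a ≤ y → y < b → Occupied w y) :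
    Occupied (a :: w) x ↔ Occupied w x ∨ b = x := by
  rw [occupied_cons]
  refine or_congr_right' fun hx => ⟨fun ⟨hax, h⟩ => ?_, ?_⟩
  · obtain hlt | heq | hgt := lt_trichotomy x b
    · exact absurd (hfirst x hax hlt) hx
    · exact heq.symm
    · exact absurd (h b hab hgt) hb
  · rintro rfl
    exact ⟨hab, hfirst⟩

/-- The preferences of the cars as a word, the most recent car first. -/
def history (p : Fin m → Fin n) : List ℕ :=
  (List.ofFn fun i => (p i : ℕ)).reverse

theorem length_history (p : Fin m → Fin n) : (history p).length = m := by
  simp [history]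

theorem mem_history {p : Fin m → Fin n} {a : ℕ} : a ∈ history p ↔ ∃ i, (p i : ℕ) = a := by
  simp [history, List.mem_ofFn']

theorem history_snoc (p : Fin m → Fin n) (a : Fin n) :
    history (Fin.snoc (α := fun _ => Fin n) p a) = (a : ℕ) :: history p := by
  simp only [history, List.ofFn_succ_last, Fin.snoc_castSucc, Fin.snoc_last, List.reverse_append,
    List.reverse_singleton, List.singleton_append]

theorem history_injective : Function.Injective (history (m := m) (n := n)) := by
  intro p p' h
  have h := List.ofFn_injective (List.reverse_injective h)
  exact funext fun i => Fin.ext (congrFun h i)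

/-- `IsOutcome` for `m` cars on a street with `n` spots, as needed for an induction on the number
of cars. -/
def IsOutcomeOf (p s : Fin m → Fin n) : Prop :=
  ∀ i, IsLeast {t : Fin n | p i ≤ t ∧ ∀ k, k < i → s k ≠ t} (s i)

theorem isOutcomeOf_snoc {p s : Fin m → Fin n} {a b : Fin n} :
    IsOutcomeOf (Fin.snoc (α := fun _ => Fin n) p a) (Fin.snoc (α := fun _ => Fin n) s b) ↔
      IsOutcomeOf p s ∧ IsLeast {t | a ≤ t ∧ ∀ k, s k ≠ t} b := by
  simp [IsOutcomeOf, Fin.forall_fin_succ', (Fin.castSucc_lt_last _).not_gt]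

theorem first_free_spot_of_isLeast {w : List ℕ} {s : Fin m → Fin n} {a b : Fin n}
    (hw : ∀ x, Occupied w x ↔ ∃ k, (s k : ℕ) = x)
    (h : IsLeast {t | a ≤ t ∧ ∀ k, s k ≠ t} b) :
    (a : ℕ) ≤ b ∧ ¬ Occupied w b ∧ ∀ y, (a : ℕ) ≤ y → y < b → Occupied w y := by
  obtain ⟨⟨hab, hb⟩, hmin⟩ := h
  refine ⟨hab, by simpa [hw, Fin.val_inj] using hb, fun y hay hyb => ?_⟩
  by_contra hy
  refine (hmin (a := ⟨y, hyb.trans b.2⟩) ⟨hay, fun k hk => hy ?_⟩).not_gt hyb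
  exact (hw y).2 ⟨k, congrArg Fin.val hk⟩

theorem IsOutcomeOf.occupied_history_iff {p s : Fin m → Fin n} (h : IsOutcomeOf p s) :
    Occupied (history p) t ↔ ∃ k, (s k : ℕ) = t := by
  induction m generalizing t with
  | zero => simp [history, not_occupied_nil]
  | succ m ih =>
    induction p using Fin.snocCases with | snoc p a
    induction s using Fin.snocCases with | snoc s b
    obtain ⟨hs, hb⟩ := isOutcomeOf_snoc.1 h
    obtain ⟨hab, hfree, hfirst⟩ := first_free_spot_of_isLeast (fun _ => ih hs) hb
    rw [history_snoc, occupied_cons_of_first_free hab hfree hfirst, ih hs]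
    simp [Fin.exists_fin_succ']

theorem IsOutcomeOf.unlucky_history_iff {p s : Fin m → Fin n} (h : IsOutcomeOf p s) :
    Unlucky t (history p) ↔ ∃ k, (s k : ℕ) = t ∧ (p k : ℕ) ≠ t := by
  induction m generalizing t with
  | zero => simp [history, Unlucky]
  | succ m ih =>
    induction p using Fin.snocCases with | snoc p a
    induction s using Fin.snocCases with | snoc s b
    obtain ⟨hs, hb⟩ := isOutcomeOf_snoc.1 h
    obtain ⟨hab, hfree, hfirst⟩ := 
      first_free_spot_of_isLeast (fun _ => hs.occupied_history_iff) hb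
    rw [history_snoc, unlucky_cons, occupied_cons_of_first_free hab hfree hfirst, ih hs]
    simp only [Fin.exists_fin_succ', Fin.snoc_castSucc, Fin.snoc_last]
    grind

theorem exists_isOutcomeOf {p : Fin m → Fin n} (h : ¬ Occupied (history p) n) :
    ∃ s, IsOutcomeOf p s := by
  induction m with
  | zero => exact ⟨Fin.elim0, fun i => i.elim0⟩
  | succ m ih =>
    induction p using Fin.snocCases with | snoc p a
    rw [history_snoc, occupied_cons] at h
    push Not at h
    obtain ⟨s, hs⟩ := ih h.1
    obtain ⟨y, hay, hyn, hy⟩ := h.2 a.2.le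
    rw [hs.occupied_history_iff] at hy
    have hne : {t | a ≤ t ∧ ∀ k, s k ≠ t}.Nonempty :=
      ⟨⟨y, hyn⟩, hay, fun k hk => hy ⟨k, congrArg Fin.val hk⟩⟩
    obtain ⟨b, hb⟩ := (Set.toFinite _).isCompact.exists_isLeast hne
    exact ⟨_, isOutcomeOf_snoc.2 ⟨hs, hb⟩⟩

theorem isParkingFunction_iff {p : Fin n → Fin n} :
    IsParkingFunction p ↔ ¬ Occupied (history p) n := by
  refine ⟨fun ⟨s, hs⟩ => ?_, exists_isOutcomeOf⟩
  rw [IsOutcomeOf.occupied_history_iff hs]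
  exact fun ⟨k, hk⟩ => (s k).2.ne hk

theorem IsOutcome.injective {p s : Fin n → Fin n} (h : IsOutcome p s) :
    Function.Injective s := by
  intro i k hik
  obtain hlt | heq | hgt := lt_trichotomy i k
  · exact absurd hik ((h k).1.2 i hlt)
  · exact heq
  · exact absurd hik.symm ((h i).1.2 k hgt)

theorem isLuckySpot_iff {p : Fin n → Fin n} {t : Fin n} :
    IsLuckySpot p t ↔ ¬ Occupied (history p) n ∧ ¬ Unlucky t (history p) := by
  rw [← isParkingFunction_iff]
  refine ⟨fun ⟨s, hs, i, hsi, hpi⟩ => ⟨⟨s, hs⟩, ?_⟩, fun ⟨⟨s, hs⟩, hlucky⟩ => ⟨s, hs, ?_⟩⟩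
  · rw [IsOutcomeOf.unlucky_history_iff hs]
    rintro ⟨k, hsk, hpk⟩
    obtain rfl := hs.injective (hsi.trans (Fin.ext hsk).symm)
    exact hpk (congrArg Fin.val hpi)
  · rw [IsOutcomeOf.unlucky_history_iff hs] at hlucky
    obtain ⟨i, hi⟩ := Finite.surjective_of_injective hs.injective t
    refine ⟨i, hi, ?_⟩
    by_contra hpi
    exact hlucky ⟨i, congrArg Fin.val hi, Fin.val_ne_of_ne hpi⟩

theorem ncard_history (P : List ℕ → Prop) (m n : ℕ) :
    {p : Fin m → Fin n | P (history p)}.ncard = wordCount (Ico 0 n) P m := by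
  classical
  rw [← Set.ncard_image_of_injective _ history_injective, wordCount, ← Set.ncard_coe_finset]
  congr 1
  ext w
  simp only [Set.mem_image, coe_filter, mem_words, mem_Ico, Nat.zero_le, true_and]
  constructor
  · rintro ⟨p, hp, rfl⟩
    refine ⟨⟨length_history p, fun a ha => ?_⟩, hp⟩
    obtain ⟨i, rfl⟩ := mem_history.1 ha
    exact (p i).2
  · rintro ⟨⟨rfl, hw⟩, hP⟩
    have hhistory : history (fun i : Fin w.length => (⟨w[i.rev], hw _ (by simp)⟩ : Fin n)) = w :=
      List.ext_getElem (by simp [history]) (fun i _ _ => by grind [history, Fin.rev])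
    exact ⟨_, by rwa [Set.mem_ofPred_eq, hhistory], hhistory⟩

theorem ncard_not_occupied_history_and (P : List ℕ → Prop) (n : ℕ) :
    {p : Fin n → Fin n | ¬ Occupied (history p) n ∧ P (history p)}.ncard =
      wordCount (Ico 0 (n + 1)) (fun w => ¬ Occupied w n ∧ P w) n := by
  rw [ncard_history (fun w => ¬ Occupied w n ∧ P w)]
  refine wordCount_congr fun w _ => ⟨fun ⟨hw, hP⟩ => ⟨fun a ha => ?_, hP⟩,
    fun ⟨hw, hP⟩ => ⟨fun a ha => ?_, hP⟩⟩
  · have := mem_Ico.1 (hw a ha)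
    exact mem_Ico.2 ⟨this.1, by lia⟩
  · have hne : a ≠ n := by rintro rfl; exact hP.1 (occupied_of_mem ha)
    have := mem_Ico.1 (hw a ha)
    exact mem_Ico.2 ⟨this.1, by lia⟩

theorem parkingCount_eq_wordCount (n : ℕ) :
    parkingCount n = wordCount (Ico 0 (n + 1)) (¬ Occupied · n) n := by
  have := ncard_not_occupied_history_and (fun _ => True) n
  simpa only [and_true, parkingCount, isParkingFunction_iff] using this

theorem parkingCount_eq (n : ℕ) : (parkingCount n : ℝ) = ((n : ℝ) + 1) ^ (n - 1) := by
  rw [parkingCount_eq_wordCount, wordCount_not_occupied_self]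
  cases n with
  | zero => simp
  | succ n => rw [pow_succ, mul_div_cancel_right₀ _ (by positivity), Nat.add_sub_cancel]

theorem luckySpotCount_eq_wordCount (h : t < n) :
    luckySpotCount n (t + 1) =
      wordCount (Ico 0 (n + 1)) (fun w => ¬ Occupied w n ∧ ¬ Unlucky t w) n := by
  rw [← ncard_not_occupied_history_and, luckySpotCount]
  congr 1
  ext p
  constructor
  · rintro ⟨u, hu, hp⟩
    obtain rfl : (u : ℕ) = t := by lia
    exact isLuckySpot_iff.1 hp
  · exact fun hp => ⟨⟨t, h⟩, rfl, isLuckySpot_iff.2 hp⟩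

theorem parkingCount_eq_luckySpotCount_add (h : t < n) :
    parkingCount n = luckySpotCount n (t + 1) +
      wordCount (Ico 0 (n + 1)) (fun w => ¬ Occupied w n ∧ Unlucky t w) n := by
  rw [parkingCount_eq_wordCount, luckySpotCount_eq_wordCount h,
    ← wordCount_and_add_and_not _ _ (Unlucky t), add_comm]

theorem columnSum_eq_luckySpotCount (n j : ℕ) : columnSum n j = luckySpotCount n j := by
  have hunion : {p : Fin n → Fin n | ∃ t : Fin n, (t : ℕ) + 1 = j ∧ IsLuckySpot p t} =
      ⋃ i : Fin n, {p : Fin n → Fin n | (p i : ℕ) + 1 = j ∧ IsLuckyCar p i} := by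
    ext p
    simp only [Set.mem_ofPred_eq, Set.mem_iUnion, IsLuckySpot, IsLuckyCar]
    constructor
    · rintro ⟨t, ht, s, hs, i, hi, rfl⟩
      exact ⟨i, ht, s, hs, hi⟩
    · rintro ⟨i, hi, s, hs, hsi⟩
      exact ⟨p i, hi, s, hs, i, hsi, rfl⟩
  rw [columnSum, luckySpotCount, hunion, Set.ncard_iUnion_of_finite, finsum_eq_sum_of_fintype]
  · rfl
  · exact fun _ => Set.toFinite _
  · intro i k hik
    rw [Function.onFun, Set.disjoint_left]
    rintro p ⟨hi, s, hs, hsi⟩ ⟨hk, s', hs', hsk⟩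
    obtain rfl := hs.unique hs'
    refine hik (hs.injective ?_)
    rw [hsi, hsk]
    exact Fin.ext (by lia)

end Outcomes

section ExactCount

variable {n t : ℕ}

theorem parkingCount_eq_luckySpotCount_add_sum (h : t < n) :
    parkingCount n = luckySpotCount n (t + 1) + ∑ z ∈ antidiagonal n, n.choose z.1 *
      (unluckyFillCount t z.1 * wordCount (Ico (t + 1) (n + 1)) (¬ Occupied · n) z.2) := by
  rw [parkingCount_eq_luckySpotCount_add h]
  simp only [unluckyFillCount]
  rw [← wordCount_Ico_filter_le_and_filter_lt (by lia) (by lia)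
    (fun w => Unlucky t w ∧ ∀ x < t, Occupied w x)]
  congr 1
  refine wordCount_congr fun w hw => and_congr_right fun hmem => ?_
  have hoverflow := not_occupied_length_iff (w := w) (t := t)
    (fun a ha => by rw [hw]; exact Nat.lt_succ_iff.1 (mem_Ico.1 (hmem a ha)).2) (by rwa [hw])
  have hleft : Unlucky t (w.filter (· ≤ t)) → Occupied (w.filter (· ≤ t)) t := Unlucky.occupied
  rw [hw, Nat.forall_lt_succ_right] at hoverflow
  rw [hoverflow, ← unlucky_filter_le le_rfl]
  tauto

theorem unluckyFillCount_mul_wordCount_not_occupied (h : t < n) {i j : ℕ} (hij : i + j = n) :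
    ((n : ℝ) - t) * (unluckyFillCount t i * wordCount (Ico (t + 1) (n + 1)) (¬ Occupied · n) j) =
      unluckyFillExtension t i * ((i - t) * (n - t) ^ j) -
        if i < t then unluckyFillExtension t i * ((i - t) * (n - t) ^ j) else 0 := by
  obtain hit | rfl | hti := lt_trichotomy i t
  · simp [unluckyFillCount_eq_zero hit.le, hit]
  · simp [unluckyFillCount_eq_zero le_rfl]
  · obtain ⟨s, rfl⟩ := Nat.exists_eq_add_of_lt h
    have hfree := add_one_mul_wordCount_not_occupied (t + 1) (by lia : j ≤ s + 1)
    have hj : (i : ℝ) + j = t + s + 1 := mod_cast hij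
    rw [add_right_comm t 1 s] at hfree
    rw [unluckyFillCount_eq_unluckyFillExtension hti, if_neg hti.not_gt, sub_zero]
    push_cast
    rw [show (t : ℝ) + s + 1 - t = s + 1 by ring, show (i : ℝ) - t = s + 1 - j by linarith]
    linear_combination unluckyFillExtension t i * hfree

theorem sum_choose_mul_unluckyFillExtension (h : t < n) :
    ∑ z ∈ antidiagonal n, (n.choose z.1 : ℝ) *
      (unluckyFillExtension t z.1 * ((z.1 - t) * (n - t) ^ z.2)) =
        t / (2 * (t + 1)) * ((n - t) * (n + 1) ^ (n - 1)) := by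
  have hmain : ∑ z ∈ antidiagonal n, (n.choose z.1 : ℝ) *
      ((z.1 + -t) * (t + 1) ^ z.1 * (n - t) ^ z.2) = (n - t) * (n + 1) ^ (n - 1) := by
    have := add_mul_sum_choose_mul_add_mul_pow n (-t : ℝ) (t + 1) (n - t)
    rw [show (t : ℝ) + 1 + (n - t) = n + 1 by ring] at this
    refine mul_left_cancel₀ (by positivity : (n : ℝ) + 1 ≠ 0) (this.trans ?_)
    rw [← pow_sub_one_mul (by lia) ((n : ℝ) + 1)]
    ring
  have hvanish : ∀ k ∈ range t, ∑ z ∈ antidiagonal n, (n.choose z.1 : ℝ) *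
      (z.1.choose k * ((z.1 + -t) * (t - k) ^ (z.1 - k) * (n - t) ^ z.2)) = 0 := fun k hk => by
    have hkn : k < n := (mem_range.1 hk).trans h
    have := add_mul_sum_choose_mul_choose_mul_add_mul_pow hkn.le (-t : ℝ) (t - k) (n - t)
    rw [show (t : ℝ) - k + (n - t) = n - k by ring] at this
    refine mul_left_cancel₀ (sub_ne_zero.2 (Nat.cast_injective.ne hkn.ne')) (this.trans ?_)
    ring
  calc
    _ = t / (2 * (t + 1)) * ∑ z ∈ antidiagonal n, (n.choose z.1 : ℝ) *
          ((z.1 + -t) * (t + 1) ^ z.1 * (n - t) ^ z.2) -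
        ∑ k ∈ range t, ((k : ℝ) + 1) ^ k / (k + 1) * (((t : ℝ) - k - 1) / (2 * (t - k))) *
          ∑ z ∈ antidiagonal n, (n.choose z.1 : ℝ) *
            (z.1.choose k * ((z.1 + -t) * (t - k) ^ (z.1 - k) * (n - t) ^ z.2)) := by
      simp only [mul_sum]
      rw [sum_comm (s := range t), ← sum_sub_distrib]
      refine sum_congr rfl fun z _ => ?_
      rw [unluckyFillExtension, sub_mul, sum_mul, mul_sub, mul_sum]
      congr 1
      · ring
      · exact sum_congr rfl fun k _ => by ring
    _ = t / (2 * (t + 1)) * ((n - t) * (n + 1) ^ (n - 1)) := by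
      rw [hmain, sum_congr rfl fun k hk => by rw [hvanish k hk, mul_zero], sum_const_zero, sub_zero]

theorem sum_choose_mul_unluckyFillCount (h : t < n) :
    ∑ z ∈ antidiagonal n, (n.choose z.1 : ℝ) *
        (unluckyFillCount t z.1 * wordCount (Ico (t + 1) (n + 1)) (¬ Occupied · n) z.2) =
      t / (2 * (t + 1)) * (n + 1) ^ (n - 1) + ∑ m ∈ range t, (n.choose m : ℝ) *
        (unluckyFillExtension t m * ((t - m) * (n - t) ^ (n - m - 1))) := by
  have hcorrection : ∑ z ∈ antidiagonal n, (n.choose z.1 : ℝ) *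
      (if z.1 < t then unluckyFillExtension t z.1 * ((z.1 - t) * (n - t) ^ z.2) else 0) =
      (n - t) * -∑ m ∈ range t, (n.choose m : ℝ) *
        (unluckyFillExtension t m * ((t - m) * (n - t) ^ (n - m - 1))) := by
    simp only [mul_ite, mul_zero]
    rw [Nat.sum_antidiagonal_eq_sum_range_succ_mk, ← sum_filter, mul_neg, mul_sum,
      ← sum_neg_distrib]
    refine sum_congr (by ext; grind) fun m hm => ?_
    rw [← pow_sub_one_mul (by grind : n - m ≠ 0)]
    ring
  refine mul_left_cancel₀ (sub_ne_zero.2 (Nat.cast_injective.ne h.ne') : (n : ℝ) - t ≠ 0) ?_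
  rw [mul_sum, sum_congr rfl fun z hz => by
    rw [mul_left_comm, unluckyFillCount_mul_wordCount_not_occupied h (mem_antidiagonal.1 hz),
      mul_sub], sum_sub_distrib, sum_choose_mul_unluckyFillExtension h, hcorrection]
  ring

theorem luckySpotCount_succ (h : t < n) :
    (luckySpotCount n (t + 1) : ℝ) = (t + 2) / (2 * (t + 1)) * (n + 1) ^ (n - 1) -
      ∑ m ∈ range t, (n.choose m : ℝ) *
        (unluckyFillExtension t m * ((t - m) * (n - t) ^ (n - m - 1))) := by
  have hcount := congrArg (Nat.cast (R := ℝ)) (parkingCount_eq_luckySpotCount_add_sum h)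
  push_cast [parkingCount_eq] at hcount
  rw [sum_choose_mul_unluckyFillCount h] at hcount
  field_simp at hcount ⊢
  linear_combination -hcount

theorem luckySpotCount_three (h : 3 ≤ n) :
    (luckySpotCount n 3 : ℝ) =
      2 / 3 * ((n : ℝ) + 1) ^ (n - 1) - 1 / 3 * (2 * (n : ℝ) - 1) * ((n : ℝ) - 2) ^ (n - 2) := by
  obtain ⟨l, rfl⟩ := Nat.exists_eq_add_of_le' h
  rw [luckySpotCount_succ (t := 2) (by lia)]
  simp only [sum_range_succ, Nat.reduceSubDiff]
  norm_num [unluckyFillExtension, sum_range_succ]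
  ring

theorem luckySpotCount_four (h : 4 ≤ n) :
    (luckySpotCount n 4 : ℝ) = 5 / 8 * ((n : ℝ) + 1) ^ (n - 1) -
      1 / 8 * (13 * (n : ℝ) ^ 2 - 26 * (n : ℝ) + 9) * ((n : ℝ) - 3) ^ (n - 3) := by
  obtain ⟨l, rfl⟩ := Nat.exists_eq_add_of_le' h
  rw [luckySpotCount_succ (t := 3) (by lia)]
  simp only [sum_range_succ, Nat.reduceSubDiff]
  norm_num [unluckyFillExtension, sum_range_succ, Nat.cast_choose_two]
  ring

theorem luckySpotCount_five (h : 5 ≤ n) :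
    (luckySpotCount n 5 : ℝ) = 3 / 5 * ((n : ℝ) + 1) ^ (n - 1) -
      1 / 30 * (118 * (n : ℝ) ^ 3 - 531 * (n : ℝ) ^ 2 + 659 * (n : ℝ) - 192) *
        ((n : ℝ) - 4) ^ (n - 4) := by
  obtain ⟨l, rfl⟩ := Nat.exists_eq_add_of_le' h
  rw [luckySpotCount_succ (t := 4) (by lia)]
  simp only [sum_range_succ, Nat.reduceSubDiff]
  norm_num [unluckyFillExtension, sum_range_succ, Nat.cast_choose_eq_descPochhammer_div,
    descPochhammer_succ_eval, Nat.factorial]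
  ring

end ExactCount

section Limits

theorem tendsto_choose_mul_sub_pow_div (t m : ℕ) :
    Tendsto (fun n : ℕ => (n.choose m : ℝ) * ((n : ℝ) - t) ^ (n - m - 1) / ((n : ℝ) + 1) ^ (n - 1))
      atTop (𝓝 (Real.exp (-(t + 1)) / m.factorial)) := by
  -- Up to a factor that tends to `(t + 1) ^ (-m)`, this is the probability of `m` successes among
  -- `n` trials with success probability `(t + 1) / (n + 1)`.
  have hone := tendsto_natCast_div_add_atTop (1 : ℝ)
  have hmean : Tendsto (fun n : ℕ => (n : ℝ) * ((t + 1) / (n + 1))) atTop (𝓝 (t + 1)) := by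
    have := hone.mul_const ((t : ℝ) + 1)
    rw [one_mul] at this
    exact this.congr fun n => by ring
  have hpoisson := ProbabilityTheory.tendsto_choose_mul_pow_of_tendsto_mul_atTop m hmean
  have hratio := (tendsto_natCast_div_add_atTop (-t : ℝ)).div hone one_ne_zero
  have hlim : Real.exp (-(t + 1)) * (t + 1) ^ m / m.factorial * (1 / 1) / (t + 1) ^ m =
      Real.exp (-(t + 1)) / m.factorial := by
    field_simp
  refine hlim ▸ ((hpoisson.mul hratio).div_const (((t : ℝ) + 1) ^ m)).congr' ?_
  filter_upwards [eventually_gt_atTop m, eventually_gt_atTop t] with n hm ht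
  obtain ⟨l, rfl⟩ := Nat.exists_eq_add_of_lt hm
  have hpos : ((m + l + 1 : ℕ) : ℝ) - t ≠ 0 := sub_ne_zero.2 (Nat.cast_injective.ne ht.ne')
  have hfree : 1 - ((t : ℝ) + 1) / ((m + l + 1 : ℕ) + 1) =
      ((m + l + 1 : ℕ) - t) / ((m + l + 1 : ℕ) + 1) := by
    field_simp
    ring
  rw [Pi.div_apply, hfree, ← sub_eq_add_neg, show m + l + 1 - m = l + 1 by lia, div_pow, div_pow,
    add_tsub_cancel_right, add_tsub_cancel_right]
  field_simp
  ring

theorem isAsymptoticProbability_succ (t : ℕ) :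
    IsAsymptoticProbability (t + 1) ((t + 2) / (2 * (t + 1)) -
      (∑ m ∈ range t, unluckyFillExtension t m * (t - m) / m.factorial) * Real.exp (-(t + 1))) := by
  have hlim : Tendsto (fun n : ℕ => (luckySpotCount n (t + 1) : ℝ) / ((n : ℝ) + 1) ^ (n - 1)) atTop
      (𝓝 ((t + 2) / (2 * (t + 1)) - ∑ m ∈ range t, unluckyFillExtension t m * (t - m) *
        (Real.exp (-(t + 1)) / m.factorial))) := by
    refine (tendsto_const_nhds.sub (tendsto_finsetSum _ fun m _ =>
      (tendsto_choose_mul_sub_pow_div t m).const_mul _)).congr' ?_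
    filter_upwards [eventually_gt_atTop t] with n hn
    rw [luckySpotCount_succ hn, sub_div, mul_div_cancel_right₀ _ (by positivity), sum_div]
    exact congrArg _ (sum_congr rfl fun m _ => by ring)
  have hvalue : ∑ m ∈ range t, unluckyFillExtension t m * (t - m) *
      (Real.exp (-(t + 1)) / m.factorial) =
        (∑ m ∈ range t, unluckyFillExtension t m * (t - m) / m.factorial) *
          Real.exp (-(t + 1)) := by
    rw [sum_mul]
    exact sum_congr rfl fun m _ => by ring
  rw [hvalue] at hlim
  exact ⟨by simpa only [columnSum_eq_luckySpotCount] using hlim,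
    by simpa only [parkingCount_eq] using hlim⟩

theorem isAsymptoticProbability_one : IsAsymptoticProbability 1 1 := by
  simpa using isAsymptoticProbability_succ 0

theorem isAsymptoticProbability_two :
    IsAsymptoticProbability 2 (3 / 4 - 1 / 4 * Real.exp (-2)) := by
  convert isAsymptoticProbability_succ 1 using 1
  norm_num [unluckyFillExtension, sum_range_succ]

theorem isAsymptoticProbability_three :
    IsAsymptoticProbability 3 (2 / 3 - 2 / 3 * Real.exp (-3)) := by
  convert isAsymptoticProbability_succ 2 using 1
  norm_num [unluckyFillExtension, sum_range_succ]

theorem isAsymptoticProbability_four :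
    IsAsymptoticProbability 4 (5 / 8 - 13 / 8 * Real.exp (-4)) := by
  convert isAsymptoticProbability_succ 3 using 1
  norm_num [unluckyFillExtension, sum_range_succ, Nat.factorial]

theorem isAsymptoticProbability_five :
    IsAsymptoticProbability 5 (3 / 5 - 59 / 15 * Real.exp (-5)) := by
  convert isAsymptoticProbability_succ 4 using 1
  norm_num [unluckyFillExtension, sum_range_succ, Nat.factorial, Nat.choose]

theorem exp_neg_natCast_mem_Ioo {k : ℕ} (hk : k ≠ 0) :
    Real.exp (-(k : ℝ)) ∈ Set.Ioo ((2.7182818286 : ℝ) ^ k)⁻¹ ((2.7182818283 : ℝ) ^ k)⁻¹ := by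
  rw [Real.exp_neg, ← mul_one (k : ℝ), Real.exp_nat_mul]
  have hlt := Real.exp_one_lt_d9
  have hgt := Real.exp_one_gt_d9
  constructor <;> gcongr

end Limits

end Parking

theorem mainTheorem9 :
    -- the column sums are the numbers of parking functions with a given lucky spot
    (∀ n j : ℕ, Parking.columnSum n j = Parking.luckySpotCount n j) ∧
    -- the exact counts for the spots 3, 4, 5
    (∀ n : ℕ, 3 ≤ n → (Parking.luckySpotCount n 3 : ℝ) =
      2 / 3 * ((n : ℝ) + 1) ^ (n - 1)
        - 1 / 3 * (2 * (n : ℝ) - 1) * ((n : ℝ) - 2) ^ (n - 2)) ∧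
    (∀ n : ℕ, 4 ≤ n → (Parking.luckySpotCount n 4 : ℝ) =
      5 / 8 * ((n : ℝ) + 1) ^ (n - 1)
        - 1 / 8 * (13 * (n : ℝ) ^ 2 - 26 * (n : ℝ) + 9) * ((n : ℝ) - 3) ^ (n - 3)) ∧
    (∀ n : ℕ, 5 ≤ n → (Parking.luckySpotCount n 5 : ℝ) =
      3 / 5 * ((n : ℝ) + 1) ^ (n - 1)
        - 1 / 30 * (118 * (n : ℝ) ^ 3 - 531 * (n : ℝ) ^ 2 + 659 * (n : ℝ) - 192)
          * ((n : ℝ) - 4) ^ (n - 4)) ∧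
    -- the limiting probabilities for the spots 1, …, 5
    Parking.IsAsymptoticProbability 1 1 ∧
    Parking.IsAsymptoticProbability 2 (3 / 4 - 1 / 4 * Real.exp (-2)) ∧
    Parking.IsAsymptoticProbability 3 (2 / 3 - 2 / 3 * Real.exp (-3)) ∧
    Parking.IsAsymptoticProbability 4 (5 / 8 - 13 / 8 * Real.exp (-4)) ∧
    Parking.IsAsymptoticProbability 5 (3 / 5 - 59 / 15 * Real.exp (-5)) ∧
    -- their decimal expansions to six places
    (3 / 4 - 1 / 4 * Real.exp (-2) ∈ Set.Ico (0.716166 : ℝ) 0.716167) ∧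
    (2 / 3 - 2 / 3 * Real.exp (-3) ∈ Set.Ico (0.633475 : ℝ) 0.633476) ∧
    (5 / 8 - 13 / 8 * Real.exp (-4) ∈ Set.Ico (0.595237 : ℝ) 0.595238) ∧
    (3 / 5 - 59 / 15 * Real.exp (-5) ∈ Set.Ico (0.573497 : ℝ) 0.573498) := by
  refine ⟨Parking.columnSum_eq_luckySpotCount, fun _ => Parking.luckySpotCount_three,
    fun _ => Parking.luckySpotCount_four, fun _ => Parking.luckySpotCount_five,
    Parking.isAsymptoticProbability_one, Parking.isAsymptoticProbability_two,
    Parking.isAsymptoticProbability_three, Parking.isAsymptoticProbability_four,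
    Parking.isAsymptoticProbability_five, ?_, ?_, ?_, ?_⟩
  · have h := Parking.exp_neg_natCast_mem_Ioo (k := 2) (by norm_num)
    norm_num at h
    constructor <;> linarith
  · have h := Parking.exp_neg_natCast_mem_Ioo (k := 3) (by norm_num)
    norm_num at h
    constructor <;> linarith
  · have h := Parking.exp_neg_natCast_mem_Ioo (k := 4) (by norm_num)
    norm_num at h
    constructor <;> linarith
  · have h := Parking.exp_neg_natCast_mem_Ioo (k := 5) (by norm_num)
    norm_num at h
    constructor <;> linarith
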